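/- There is an absolute constant $K>0$ such that the following holds. Let $G=(V,E)$ be a finite unweighted graph, undirected or directed, with $n=|V|$ vertices, whose edges are colored arbitrarily so that every color class contains at most $\Delta$ edges, and let $P\subseteq V\times V$. For a set $F$ of colors and a subgraph $H$ of $G$ (with the inherited coloring), let $H-F$ be the graph obtained from $H$ by deleting all edges whose color lies in $F$. Then $G$ has a $1$-color-fault-tolerant ($1$-CFT) $P$-distance preserver, that is, a subgraph $H\subseteq G$ with $$\operatorname{dist}_{H-F}(s,t)=\operatorname{dist}_{G-F}(s,t)\quad\text{for every } (s,t)\in P \text{ and every set } F \text{ of at most one color}$$ (distances are $\infty$ when there is no path), such that $$|E(H)|\le K\cdot n^{2-\frac{2}{2\Delta+3}}\cdot |P|^{\frac{1}{2\Delta+3}}\cdot \Delta\log n .$$ -/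

import Mathlib

/-! Unweighted graphs on a vertex type `V` with edges colored by `C`, undirected (`SimpleGraph V`,
coloring `Sym2 V → C`) or directed (`Digraph V`, coloring `V × V → C`). Only the values of the
coloring on actual edges matter. A spanning subgraph `H ≤ G` carries the same coloring. -/

namespace ColorFT

universe u v

section Undirected

variable {V : Type u} {C : Type v}

/-- Every color class of the edge-colored undirected graph `G` has at most `Δ` edges. -/
def ClassesLE (G : SimpleGraph V) (col : Sym2 V → C) (Δ : ℕ) : Prop :=
  ∀ c : C, {e | e ∈ G.edgeSet ∧ col e = c}.encard ≤ Δ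

/-- `G - F`: delete all edges whose color lies in `F`. -/
def deleteColors (G : SimpleGraph V) (col : Sym2 V → C) (F : Set C) : SimpleGraph V :=
  G.deleteEdges {e | col e ∈ F}

/-- `H` is an `f`-color-fault-tolerant `P`-distance preserver of `G`: it is a subgraph of `G`, and
for each set `F` of at most `f` colors and each `(s, t) ∈ P`, the distance (`⊤` if there is no path)
from `s` to `t` is the same in `H - F` and in `G - F`. -/
def IsDistPreserver (f : ℕ) (G : SimpleGraph V) (col : Sym2 V → C) (P : Set (V × V))
    (H : SimpleGraph V) : Prop :=
  H ≤ G ∧ ∀ F : Set C, F.encard ≤ f → ∀ p ∈ P,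
    (deleteColors H col F).edist p.1 p.2 = (deleteColors G col F).edist p.1 p.2

end Undirected

section Directed

variable {V : Type u} {C : Type v}

/-- The set of directed edges `(u, v)` of a digraph. -/
def diEdgeSet (G : Digraph V) : Set (V × V) := {e | G.Adj e.1 e.2}

/-- `DiWalk G u v k`: there is a directed walk with `k` edges from `u` to `v` in `G`. -/
inductive DiWalk (G : Digraph V) : V → V → ℕ → Prop
  | nil (u : V) : DiWalk G u u 0
  | cons {u v w : V} {k : ℕ} : G.Adj u v → DiWalk G v w k → DiWalk G u w (k + 1)

/-- The directed distance from `u` to `v`: the least number of edges of a directed walk from `u`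
to `v`, and `⊤` if there is none. -/
noncomputable def diDist (G : Digraph V) (u v : V) : ℕ∞ :=
  sInf {d : ℕ∞ | ∃ k : ℕ, DiWalk G u v k ∧ d = k}

/-- Every color class of the edge-colored digraph `G` has at most `Δ` directed edges. -/
def DiClassesLE (G : Digraph V) (col : V × V → C) (Δ : ℕ) : Prop :=
  ∀ c : C, {e | e ∈ diEdgeSet G ∧ col e = c}.encard ≤ Δ

/-- `G - F`: delete all directed edges whose color lies in `F`. -/
def diDeleteColors (G : Digraph V) (col : V × V → C) (F : Set C) : Digraph V where
  Adj u v := G.Adj u v ∧ col (u, v) ∉ F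

/-- The directed version of `IsDistPreserver`. -/
def IsDiDistPreserver (f : ℕ) (G : Digraph V) (col : V × V → C) (P : Set (V × V))
    (H : Digraph V) : Prop :=
  H ≤ G ∧ ∀ F : Set C, F.encard ≤ f → ∀ p ∈ P,
    diDist (diDeleteColors H col F) p.1 p.2 = diDist (diDeleteColors G col F) p.1 p.2

end Directed

/-- The size bound `n ^ (2 - 2 / (2 Δ + 3)) * p ^ (1 / (2 Δ + 3)) * Δ * log n`. -/
noncomputable def sizeBound (n p Δ : ℕ) : ℝ :=
  (n : ℝ) ^ (2 - 2 / (2 * (Δ : ℝ) + 3)) * (p : ℝ) ^ (1 / (2 * (Δ : ℝ) + 3)) * (Δ * Real.log n)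

end ColorFT

/-! The undirected and the directed case both follow from a statement about digraphs in which the
bound on the color classes is replaced by a bound on *levels*: for a target `v`, the level of an
edge on some shortest path to `v` is the distance from its head to `v`, and each color has at most
`Δ` levels. This holds for digraphs with color classes of size at most `Δ`, and also for the
symmetric digraph of an undirected graph, since only one orientation of an edge can lie on a
shortest path to `v`.

Let `L i = r ^ (Δ + 1 - i)`, and let `S i`, for `i ≤ Δ`, be a set of `O(n log n / L i)` vertices that
meets shortest paths with `L i` vertices in all the graphs `G - F` (`exists_hits`; a random set would
do, and a union bound shows that one exists).

Distances from `S 0` are preserved by `lastEdges`: for every `i ≤ Δ`, `x ∈ S i` and `v`, one takes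
the last edge of a shortest path from `x` to `v`, in `G` and in `G - c` for each color `c` on the last
`L (i + 1)` edges of the fixed shortest path of `G` from `x` to `v`. These suffice
(`exists_lastEdge`): if the color `c` fails and is on this path, but not on its last `L (i + 1)` edges,
then `c` has a level in `[L (i + 1), dist (x, v))`. A shortest path of `G - c` from `x` to `v` can be
taken to pass through some `x' ∈ S (i + 1)` within distance `L (i + 1)` of `v`, and it is enough to
treat `x'`, below which `c` has fewer levels. As `c` has at most `Δ` levels, this stops at `i = Δ` at
the latest. The number of edges is `n * ∑ i, |S i| * (L (i + 1) + 1) = O(Δ n ^ 2 log n / r)`.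
Reversing all edges preserves the distances to `S 0` in the same way.

For a pair `(s, t)` whose distance after the fault exceeds `L 0`, some shortest path passes through
`S 0`, and the two preservers apply (`diWalk_preserverEdges`). If it is at most `L 0`, then the
fault-free path is at most that long as well, and one adds the at most `L 0 + 1` different
replacement paths entirely, which costs `O(|P| * r ^ (2 Δ + 2))` edges. The choice
`r ≈ (n ^ 2 / |P|) ^ (1 / (2 Δ + 3))` balances the two terms (`exists_scale`). -/

namespace ColorFT

open Finset

/-! ### Walks and distances in digraphs -/

section Walks

variable {V : Type*} {C : Type*} {G D : Digraph V} {u v w : V}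

theorem DiWalk.append {a b : ℕ} (h₁ : DiWalk G u v a) (h₂ : DiWalk G v w b) :
    DiWalk G u w (a + b) := by
  induction h₁ with
  | nil u => simpa using h₂
  | cons hadj _ ih =>
    rw [add_right_comm]
    exact .cons hadj (ih h₂)

theorem DiWalk.concat {k : ℕ} (h : DiWalk G u v k) (hadj : G.Adj v w) : DiWalk G u w (k + 1) :=
  h.append (.cons hadj (.nil w))

theorem DiWalk.mono {k : ℕ} (hGD : ∀ a b, G.Adj a b → D.Adj a b) (h : DiWalk G u v k) :
    DiWalk D u v k := by
  induction h with
  | nil u => exact .nil u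
  | cons hadj _ ih => exact .cons (hGD _ _ hadj) ih

theorem DiWalk.eq_of_zero {k : ℕ} (h : DiWalk G u v k) (hk : k = 0) : u = v := by
  cases h with
  | nil => rfl
  | cons => omega

theorem DiWalk.exists_split {k a b : ℕ} (h : DiWalk G u v k) (hk : k = a + b) :
    ∃ x, DiWalk G u x a ∧ DiWalk G x v b := by
  induction h generalizing a with
  | nil u =>
    obtain ⟨rfl, rfl⟩ : a = 0 ∧ b = 0 := by omega
    exact ⟨u, .nil u, .nil u⟩
  | @cons u y w k hadj hw ih =>
    cases a with
    | zero =>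
      obtain rfl : b = k + 1 := by omega
      exact ⟨u, .nil u, .cons hadj hw⟩
    | succ a =>
      obtain ⟨x, h₁, h₂⟩ := ih (a := a) (by omega)
      exact ⟨x, .cons hadj h₁, h₂⟩

theorem DiWalk.exists_fun {k : ℕ} (h : DiWalk G u v k) :
    ∃ f : ℕ → V, f 0 = u ∧ f k = v ∧ ∀ i < k, G.Adj (f i) (f (i + 1)) := by
  induction h with
  | nil u => exact ⟨fun _ => u, rfl, rfl, by simp⟩
  | @cons u y w k hadj hw ih =>
    obtain ⟨f, h0, hk, hf⟩ := ih
    refine ⟨fun i => Nat.casesOn i u f, rfl, hk, fun i hi => ?_⟩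
    cases i with
    | zero => simpa [h0] using hadj
    | succ i => exact hf i (by omega)

theorem diWalk_of_fun {f : ℕ → V} {k : ℕ} (hf : ∀ i < k, G.Adj (f i) (f (i + 1))) (i j : ℕ)
    (hij : i + j ≤ k) : DiWalk G (f i) (f (i + j)) j := by
  induction j with
  | zero => exact .nil _
  | succ j ih => exact (ih (by omega)).concat (hf _ (by omega))

theorem diDist_le {k : ℕ} (h : DiWalk G u v k) : diDist G u v ≤ k :=
  sInf_le ⟨k, h, rfl⟩

theorem diWalk_of_diDist_eq {k : ℕ} (h : diDist G u v = k) : DiWalk G u v k := by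
  have hne : {d : ℕ∞ | ∃ k : ℕ, DiWalk G u v k ∧ d = k}.Nonempty := by
    by_contra hcon
    rw [Set.not_nonempty_iff_eq_empty] at hcon
    simp [diDist, hcon] at h
  obtain ⟨k', hw, hk'⟩ := csInf_mem hne
  have : (k' : ℕ∞) = k := hk'.symm.trans h
  rw [Nat.cast_inj] at this
  exact this ▸ hw

theorem diDist_le_of_diWalk (h : ∀ k : ℕ, diDist G u v = k → DiWalk D u v k) :
    diDist D u v ≤ diDist G u v := by
  by_cases htop : diDist G u v = ⊤
  · simp [htop]
  · obtain ⟨k, hk⟩ := ENat.ne_top_iff_exists.1 htop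
    rw [← hk]
    exact diDist_le (h k hk.symm)

theorem diDist_triangle (G : Digraph V) (u v w : V) :
    diDist G u w ≤ diDist G u v + diDist G v w := by
  by_cases h₁ : diDist G u v = ⊤
  · simp [h₁]
  by_cases h₂ : diDist G v w = ⊤
  · simp [h₂]
  obtain ⟨a, ha⟩ := ENat.ne_top_iff_exists.1 h₁
  obtain ⟨b, hb⟩ := ENat.ne_top_iff_exists.1 h₂
  rw [← ha, ← hb]
  exact_mod_cast diDist_le ((diWalk_of_diDist_eq ha.symm).append (diWalk_of_diDist_eq hb.symm))

theorem diDist_anti (hGD : ∀ a b, G.Adj a b → D.Adj a b) (u v : V) :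
    diDist D u v ≤ diDist G u v := by
  refine le_sInf ?_
  rintro _ ⟨k, hw, rfl⟩
  exact diDist_le (hw.mono hGD)

/-- A vertex splitting a shortest walk into two parts of lengths `a` and `b` splits the distance
in the same way. -/
theorem diDist_eq_of_split {x : V} {a b : ℕ} (h : diDist G u v = (a + b : ℕ))
    (h₁ : DiWalk G u x a) (h₂ : DiWalk G x v b) : diDist G u x = a ∧ diDist G x v = b := by
  have l₁ := diDist_le h₁
  have l₂ := diDist_le h₂
  have tri := diDist_triangle G u x v
  obtain ⟨a', ha⟩ := ENat.ne_top_iff_exists.1 (ne_top_of_le_ne_top (ENat.natCast_ne_top a) l₁)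
  obtain ⟨b', hb⟩ := ENat.ne_top_iff_exists.1 (ne_top_of_le_ne_top (ENat.natCast_ne_top b) l₂)
  rw [← ha] at l₁ tri ⊢
  rw [← hb] at l₂ tri ⊢
  rw [h] at tri
  norm_cast at *
  omega

theorem exists_diDist_split {a b : ℕ} (h : diDist G u v = (a + b : ℕ)) :
    ∃ x, diDist G u x = a ∧ diDist G x v = b := by
  obtain ⟨x, h₁, h₂⟩ := (diWalk_of_diDist_eq h).exists_split rfl
  exact ⟨x, diDist_eq_of_split h h₁ h₂⟩

theorem exists_natCast_of_add_eq {a b : ℕ∞} {k : ℕ} (h : a + b = k) :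
    ∃ i j : ℕ, a = i ∧ b = j ∧ i + j = k := by
  have ha : a ≠ ⊤ := by rintro rfl; simp at h
  have hb : b ≠ ⊤ := by rintro rfl; simp at h
  obtain ⟨i, rfl⟩ := ENat.ne_top_iff_exists.1 ha
  obtain ⟨j, rfl⟩ := ENat.ne_top_iff_exists.1 hb
  exact ⟨i, j, rfl, rfl, by exact_mod_cast h⟩

/-- A fixed shortest walk from `u` to `v`, as the sequence of its vertices; only the indices up to
the distance from `u` to `v` matter. It is the constant sequence `u` if `v` is not reachable. -/
noncomputable def shortestPath (G : Digraph V) (u v : V) : ℕ → V :=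
  open Classical in
  if h : ∃ f : ℕ → V, f 0 = u ∧ f (diDist G u v).toNat = v ∧
      ∀ i < (diDist G u v).toNat, G.Adj (f i) (f (i + 1)) then h.choose else fun _ => u

theorem shortestPath_spec {k : ℕ} (h : diDist G u v = k) :
    shortestPath G u v 0 = u ∧ shortestPath G u v k = v ∧
      ∀ i < k, G.Adj (shortestPath G u v i) (shortestPath G u v (i + 1)) := by
  have hex : ∃ f : ℕ → V, f 0 = u ∧ f (diDist G u v).toNat = v ∧
      ∀ i < (diDist G u v).toNat, G.Adj (f i) (f (i + 1)) := by
    simpa [h] using (diWalk_of_diDist_eq h).exists_fun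
  have hs := hex.choose_spec
  rw [shortestPath, dif_pos hex]
  simpa only [h, ENat.toNat_natCast] using hs

theorem diDist_shortestPath {k i j : ℕ} (h : diDist G u v = k) (hk : i + j = k) :
    diDist G u (shortestPath G u v i) = i ∧ diDist G (shortestPath G u v i) v = j := by
  subst hk
  obtain ⟨h0, hk, hf⟩ := shortestPath_spec h
  have h₁ := diWalk_of_fun hf 0 i (by omega)
  have h₂ := diWalk_of_fun hf i j le_rfl
  rw [h0, zero_add] at h₁
  rw [hk] at h₂
  exact diDist_eq_of_split h h₁ h₂

end Walks

/-! ### Restriction and reversal -/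

section Constructions

variable {V : Type*} {C : Type*}

/-- The spanning subgraph of `G` whose edges are those in `E`; pairs in `E` that are not edges of
`G` are ignored. -/
def restrict (G : Digraph V) (E : Set (V × V)) : Digraph V where
  Adj u v := G.Adj u v ∧ (u, v) ∈ E

theorem restrict_walk_mono {G : Digraph V} {col : V × V → C} {F : Set C} {E E' : Set (V × V)}
    (h : E ⊆ E') {u v : V} {k : ℕ} (hw : DiWalk (diDeleteColors (restrict G E) col F) u v k) :
    DiWalk (diDeleteColors (restrict G E') col F) u v k := by
  refine hw.mono ?_
  rintro a b ⟨⟨hG, hE⟩, hF⟩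
  exact ⟨⟨hG, h hE⟩, hF⟩

/-- The digraph with all edges reversed. -/
def reverse (G : Digraph V) : Digraph V where
  Adj u v := G.Adj v u

theorem DiWalk.reverse {G : Digraph V} {u v : V} {k : ℕ} (h : DiWalk G u v k) :
    DiWalk (reverse G) v u k := by
  induction h with
  | nil u => exact .nil u
  | cons hadj _ ih => exact ih.concat hadj

theorem diDist_reverse (G : Digraph V) (u v : V) : diDist (reverse G) u v = diDist G v u := by
  have : ∀ k, DiWalk (reverse G) u v k ↔ DiWalk G v u k := fun k =>
    ⟨fun h => h.reverse, fun h => h.reverse⟩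
  simp only [diDist, this]

theorem diDist_deleteColors_reverse (G : Digraph V) (col : V × V → C) (F : Set C) (u v : V) :
    diDist (diDeleteColors (reverse G) (col ∘ Prod.swap) F) u v =
      diDist (diDeleteColors G col F) v u :=
  diDist_reverse (diDeleteColors G col F) u v

theorem diDist_le_deleteColors (G : Digraph V) (col : V × V → C) (F : Set C) (u v : V) :
    diDist G u v ≤ diDist (diDeleteColors G col F) u v := by
  refine diDist_anti ?_ u v
  rintro a b ⟨h, -⟩
  exact h

end Constructions

/-! ### Hitting sets -/

section Hitting

theorem exists_hitting_set_of_card_lt {ι V : Type*} [Fintype ι] [Fintype V]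
    (B : ι → Finset V) (L k : ℕ) (hB : ∀ i, L ≤ #(B i))
    (hk : Fintype.card ι * (Fintype.card V - L) ^ k < Fintype.card V ^ k) :
    ∃ S : Finset V, #S ≤ k ∧ ∀ i, ∃ x ∈ S, x ∈ B i := by
  classical
  -- Otherwise every `k`-tuple of vertices avoids some `B i`, contradicting the count.
  by_contra! hcon
  have hcov : (univ : Finset (Fin k → V)) ⊆
      univ.biUnion fun i => Fintype.piFinset fun _ : Fin k => (B i)ᶜ := by
    intro f _
    obtain ⟨i, hi⟩ := hcon (univ.image f) (card_image_le.trans (by simp))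
    simp only [mem_biUnion, mem_univ, true_and, Fintype.mem_piFinset, mem_compl]
    exact ⟨i, fun a => hi _ (mem_image_of_mem f (mem_univ a))⟩
  have h₁ := (card_le_card hcov).trans card_biUnion_le
  have h₂ : ∀ i ∈ (univ : Finset ι), #(Fintype.piFinset fun _ : Fin k => (B i)ᶜ) ≤
      (Fintype.card V - L) ^ k := by
    intro i _
    rw [Fintype.card_piFinset_const, card_compl]
    exact Nat.pow_le_pow_left (Nat.sub_le_sub_left (hB i) _) k
  have h₃ := h₁.trans (sum_le_card_nsmul _ _ _ h₂)
  simp only [card_univ, Fintype.card_fun, Fintype.card_fin, smul_eq_mul] at h₃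
  omega

/-- At most `n ^ 5` subsets of size at least `L` of an `n`-element set have a common hitting set
of size `O(n log n / L)`. -/
theorem exists_hitting_set {ι V : Type*} [Fintype ι] [Fintype V] (hn : 2 ≤ Fintype.card V)
    (hι : Fintype.card ι ≤ Fintype.card V ^ 5) (B : ι → Finset V) (L : ℕ) (hL : 1 ≤ L)
    (hB : ∀ i, L ≤ #(B i)) :
    ∃ S : Finset V, (#S : ℝ) * L ≤ 7 * (Fintype.card V * Real.log (Fintype.card V)) ∧
      ∀ i, ∃ x ∈ S, x ∈ B i := by
  set n := Fintype.card V with hn_def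
  have hn0 : (0 : ℝ) < n := by positivity
  have hlog : (1 / 2 : ℝ) ≤ Real.log n := by
    have h2 : Real.log 2 ≤ Real.log n := Real.log_le_log (by norm_num) (by exact_mod_cast hn)
    linarith [Real.log_two_gt_d9]
  rcases isEmpty_or_nonempty ι with hempty | ⟨⟨i₀⟩⟩
  · exact ⟨∅, by simp; positivity, fun i => (hempty.false i).elim⟩
  have hLn : L ≤ n := (hB i₀).trans (card_le_univ _)
  have hL0 : (0 : ℝ) < L := by exact_mod_cast hL
  have hLn' : (L : ℝ) ≤ n := by exact_mod_cast hLn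
  set k := ⌊(n / L : ℝ) * (5 * Real.log n)⌋₊ + 1 with hk_def
  have hk_lo : (n / L : ℝ) * (5 * Real.log n) < k := by
    rw [hk_def]; push_cast; exact Nat.lt_floor_add_one _
  have hk_hi : (k : ℝ) ≤ (n / L : ℝ) * (5 * Real.log n) + 1 := by
    rw [hk_def]; push_cast
    gcongr
    exact Nat.floor_le (by positivity)
  have key : Fintype.card ι * (n - L) ^ k < n ^ k := by
    have hreal : (n : ℝ) ^ 5 * ((n : ℝ) - L) ^ k < (n : ℝ) ^ k := by
      have h₁ : ((n : ℝ) - L) ≤ n * Real.exp (-(L / n)) := by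
        have := Real.add_one_le_exp (-(L / n : ℝ))
        calc (n : ℝ) - L = n * (-(L / n) + 1) := by field_simp; ring
          _ ≤ _ := by gcongr
      have h₂ : ((n : ℝ) - L) ^ k ≤ n ^ k * Real.exp (-(k * (L / n))) := by
        calc ((n : ℝ) - L) ^ k ≤ (n * Real.exp (-(L / n))) ^ k :=
              pow_le_pow_left₀ (by linarith) h₁ k
          _ = _ := by rw [mul_pow, ← Real.exp_nat_mul]; ring_nf
      have h₃ : (n : ℝ) ^ 5 = Real.exp (5 * Real.log n) := by
        rw [← Real.exp_log hn0, ← Real.exp_nat_mul]; simp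
      have h₄ : 5 * Real.log n < k * (L / n) := by
        calc 5 * Real.log n = (n / L : ℝ) * (5 * Real.log n) * (L / n) := by field_simp
          _ < _ := by gcongr
      calc (n : ℝ) ^ 5 * ((n : ℝ) - L) ^ k
          ≤ Real.exp (5 * Real.log n) * (n ^ k * Real.exp (-(k * (L / n)))) := by
            rw [h₃]; gcongr
        _ = n ^ k * Real.exp (5 * Real.log n - k * (L / n)) := by
            rw [sub_eq_add_neg, Real.exp_add]; ring
        _ < n ^ k * 1 := by
            gcongr
            rw [Real.exp_lt_one_iff]
            linarith
        _ = n ^ k := mul_one _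
    have : ((Fintype.card ι * (n - L) ^ k : ℕ) : ℝ) < ((n ^ k : ℕ) : ℝ) := by
      push_cast [Nat.cast_sub hLn]
      refine lt_of_le_of_lt ?_ hreal
      have : (Fintype.card ι : ℝ) ≤ (n : ℝ) ^ 5 := by exact_mod_cast hι
      have : (0 : ℝ) ≤ (n : ℝ) - L := by linarith
      gcongr
    exact_mod_cast this
  obtain ⟨S, hS, hhit⟩ := exists_hitting_set_of_card_lt B L k hB key
  refine ⟨S, ?_, hhit⟩
  calc (#S : ℝ) * L ≤ ((n / L : ℝ) * (5 * Real.log n) + 1) * L := by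
        gcongr
        exact le_trans (by exact_mod_cast hS) hk_hi
    _ = 5 * (n * Real.log n) + L := by field_simp
    _ ≤ 7 * (n * Real.log n) := by nlinarith

end Hitting

/-! ### Replacement paths -/

section Replacement

variable {V : Type*} {C : Type*} {G : Digraph V} {col : V × V → C} {F : Set C} {u v x y : V}

/-- The edge of the fixed shortest path from `u` to `v` which has `t` edges after it. -/
noncomputable def edgeFromEnd (G : Digraph V) (u v : V) (t : ℕ) : V × V :=
  (shortestPath G u v ((diDist G u v).toNat - (t + 1)),
    shortestPath G u v ((diDist G u v).toNat - (t + 1) + 1))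

/-- For `t < l`, the graph `G` without the color of the edge of the fixed shortest path from `u` to
`v` which has `t` edges after it; for `t ≥ l`, the graph `G` itself. As `t` ranges over `0, …, l`,
these are all the situations in which no fault or a fault among the last `l` edges occurs. -/
noncomputable def replacementGraph (G : Digraph V) (col : V × V → C) (u v : V) (l t : ℕ) :
    Digraph V :=
  if t < l then diDeleteColors G col {col (edgeFromEnd G u v t)} else G

/-- If the faults on the fixed shortest path from `u` to `v` are confined to its last `l` edges,
then one of the `l + 1` graphs `replacementGraph G col u v l t` supplies a shortest path of `G - F`. -/
theorem exists_replacementGraph (hF : F.Subsingleton) {k l : ℕ}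
    (hk : diDist (diDeleteColors G col F) u v = k)
    (hl : ∀ t : ℕ, (t : ℕ∞) < diDist G u v → col (edgeFromEnd G u v t) ∈ F → t < l) :
    ∃ t < l + 1, diDist (replacementGraph G col u v l t) u v = k ∧
      ∀ i < k, (diDeleteColors G col F).Adj
        (shortestPath (replacementGraph G col u v l t) u v i)
        (shortestPath (replacementGraph G col u v l t) u v (i + 1)) := by
  by_cases hex : ∃ t : ℕ, (t : ℕ∞) < diDist G u v ∧ col (edgeFromEnd G u v t) ∈ F
  · obtain ⟨t, ht, hc⟩ := hex
    have htl := hl t ht hc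
    have hFc : F = {col (edgeFromEnd G u v t)} := hF.eq_singleton_of_mem hc
    have hD : replacementGraph G col u v l t = diDeleteColors G col F := by
      rw [replacementGraph, if_pos htl, ← hFc]
    exact ⟨t, by omega, by rw [hD, hk], by rw [hD]; exact (shortestPath_spec hk).2.2⟩
  · push Not at hex
    have hD : replacementGraph G col u v l l = G := by
      rw [replacementGraph, if_neg (lt_irrefl l)]
    have hle := diDist_le_deleteColors G col F u v
    rw [hk] at hle
    obtain ⟨d, hd⟩ := ENat.ne_top_iff_exists.1 (ne_top_of_le_ne_top (ENat.natCast_ne_top k) hle)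
    obtain ⟨h0, hend, hadj⟩ := shortestPath_spec hd.symm
    have hadj' : ∀ i < d, (diDeleteColors G col F).Adj
        (shortestPath G u v i) (shortestPath G u v (i + 1)) := by
      intro i hi
      refine ⟨hadj i hi, ?_⟩
      have := hex (d - (i + 1)) (by rw [← hd]; norm_cast; omega)
      rwa [edgeFromEnd, ← hd, ENat.toNat_natCast,
        show d - (d - (i + 1) + 1) = i by omega] at this
    have hw := diWalk_of_fun hadj' 0 d (by omega)
    rw [zero_add, h0, hend] at hw
    have hdk : d = k := by
      have h₁ := diDist_le hw
      rw [hk] at h₁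
      rw [← hd] at hle
      norm_cast at h₁ hle
      omega
    subst hdk
    exact ⟨l, by omega, by rw [hD, hd], by rw [hD]; exact hadj'⟩

/-- The levels, that is the distances from the head to `v`, of those edges of color `c` that lie on
some shortest path of `G` to `v`. -/
def tightLevels (G : Digraph V) (col : V × V → C) (v : V) (c : C) : Set ℕ :=
  {t | ∃ a b, G.Adj a b ∧ col (a, b) = c ∧ diDist G a v = (t + 1 : ℕ) ∧ diDist G b v = t}

theorem mem_tightLevels {t : ℕ} (ht : (t : ℕ∞) < diDist G u v) (hfin : diDist G u v ≠ ⊤) :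
    t ∈ tightLevels G col v (col (edgeFromEnd G u v t)) := by
  obtain ⟨d, hd⟩ := ENat.ne_top_iff_exists.1 hfin
  rw [← hd] at ht
  have ht' : t < d := by exact_mod_cast ht
  simp only [edgeFromEnd, ← hd, ENat.toNat_natCast]
  exact ⟨_, _, (shortestPath_spec hd.symm).2.2 _ (by omega), rfl,
    (diDist_shortestPath hd.symm (by omega)).2, (diDist_shortestPath hd.symm (by omega)).2⟩

end Replacement

/-! ### Sourcewise preservers -/

section Sourcewise

variable {V : Type*} {C : Type*} {G : Digraph V} {col : V × V → C} {F : Set C}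

/-- The last edges of the replacement paths from the vertices of `S i`, `i ≤ m`, to all vertices,
for no fault and for faults among the last `L (i + 1)` edges of the fixed shortest path. -/
noncomputable def lastEdges [Fintype V] (G : Digraph V) (col : V × V → C) (S : ℕ → Finset V) (L : ℕ → ℕ)
    (m : ℕ) : Finset (V × V) :=
  open Classical in
  (range (m + 1)).biUnion fun i =>
    (S i ×ˢ (univ : Finset V) ×ˢ range (L (i + 1) + 1)).image fun q =>
      let D := replacementGraph G col q.1 q.2.1 (L (i + 1)) q.2.2
      (shortestPath D q.1 q.2.1 ((diDist D q.1 q.2.1).toNat - 1), q.2.1)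

theorem card_lastEdges_le [Fintype V] (G : Digraph V) (col : V × V → C) (S : ℕ → Finset V) (L : ℕ → ℕ)
    (m : ℕ) : #(lastEdges G col S L m) ≤
      ∑ i ∈ range (m + 1), #(S i) * (Fintype.card V * (L (i + 1) + 1)) := by
  classical
  refine card_biUnion_le.trans (sum_le_sum fun i _ => card_image_le.trans ?_)
  simp [card_product]

/-- `S` meets some shortest path between any two vertices at distance `l - 1`, after any fault of at
most one color. Such a path has `l` vertices; the condition is invariant under reversal. -/
def Hits (G : Digraph V) (col : V × V → C) (S : Finset V) (l : ℕ) : Prop :=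
  ∀ F : Set C, F.Subsingleton → ∀ u y, diDist (diDeleteColors G col F) u y = (l - 1 : ℕ) →
    ∃ x ∈ S, diDist (diDeleteColors G col F) u x + diDist (diDeleteColors G col F) x y
      = (l - 1 : ℕ)

/-- Some shortest path of `G - F` from `x ∈ S i` to `v` ends with an edge of `lastEdges`. By
construction this is so unless the fixed shortest path of `G` has a faulty edge before its last
`L (i + 1)` edges, hence at level at least `L (i + 1)`. In that case one moves on to a vertex of
`S (i + 1)` at distance at most `L (i + 1)` from `v`: the level of that edge is then not below the
distance any more, and the bound `m` on the number of levels below the distance drops. -/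
theorem exists_lastEdge [Fintype V] {S : ℕ → Finset V} {L : ℕ → ℕ} {Δ : ℕ} (hL : ∀ i, 1 ≤ L i)
    (hS : ∀ i ≤ Δ, Hits G col (S i) (L i)) (hF : F.Subsingleton) (v : V) (m : ℕ) :
    ∀ i, i + m = Δ → ∀ x ∈ S i, ∀ k : ℕ, diDist (diDeleteColors G col F) x v = (k + 1 : ℕ) →
      (∀ c ∈ F, {t | t ∈ tightLevels G col v c ∧ t < k + 1}.encard ≤ m) →
      ∃ y, (diDeleteColors G col F).Adj y v ∧ (y, v) ∈ lastEdges G col S L Δ ∧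
        diDist (diDeleteColors G col F) x y = k := by
  classical
  induction m with
  | zero => ?_
  | succ m ih => ?_
  all_goals
    intro i hi x hx k hk hlev
    by_cases hall : ∀ t : ℕ, (t : ℕ∞) < diDist G x v → col (edgeFromEnd G x v t) ∈ F →
        t < L (i + 1)
    · obtain ⟨t, ht, hD, hadj⟩ := exists_replacementGraph hF hk hall
      obtain ⟨h0, hend, -⟩ := shortestPath_spec hD
      set D := replacementGraph G col x v (L (i + 1)) t with hDdef
      have hlast := hadj k (by omega)
      have hw := diWalk_of_fun hadj 0 k (by omega)
      rw [hend] at hlast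
      rw [h0, zero_add] at hw
      refine ⟨shortestPath D x v k, hlast, ?_, ?_⟩
      · refine mem_biUnion.2 ⟨i, mem_range.2 (by omega), mem_image.2 ⟨(x, v, t), ?_, ?_⟩⟩
        · simp [hx, ht]
        · simp only [← hDdef, hD, ENat.toNat_natCast, Nat.add_sub_cancel]
      · exact (diDist_eq_of_split hk hw (.cons hlast (.nil v))).1
    push Not at hall
    obtain ⟨t, ht, hc, htL⟩ := hall
    have hle := diDist_le_deleteColors G col F x v
    rw [hk] at hle
    have hmem : t ∈ tightLevels G col v (col (edgeFromEnd G x v t)) :=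
      mem_tightLevels ht (ne_top_of_le_ne_top (ENat.natCast_ne_top _) hle)
    have htk : t < k + 1 := by exact_mod_cast ht.trans_le hle
  · have := hlev _ hc
    rw [Nat.cast_zero, nonpos_iff_eq_zero, Set.encard_eq_zero] at this
    exact absurd (show t ∈ {t | t ∈ _ ∧ t < k + 1} from ⟨hmem, htk⟩) (this ▸ Set.notMem_empty t)
  -- `u` is the vertex at distance `L (i + 1)` before `v` on a shortest path of `G - F`, and `y` its
  -- last vertex before `v`; hitting the part from `u` to `y` gives `z ≠ v`.
  · have hL' := hL (i + 1)
    set l := L (i + 1) with hl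
    have hk' : k + 1 = (k + 1 - l) + ((l - 1) + 1) := by omega
    rw [hk'] at hk
    obtain ⟨u, hxu, huv⟩ := exists_diDist_split hk
    obtain ⟨y, huy, hyv⟩ := exists_diDist_split huv
    obtain ⟨z, hz, hsum⟩ := hS (i + 1) (by omega) F hF u y huy
    obtain ⟨a, b, ha, hb, hab⟩ := exists_natCast_of_add_eq hsum
    have huv' : diDist (diDeleteColors G col F) u v = (a + (b + 1) : ℕ) := by
      rw [huv, ← hab, add_assoc]
    obtain ⟨-, hzv⟩ := diDist_eq_of_split huv' (diWalk_of_diDist_eq ha)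
      ((diWalk_of_diDist_eq hb).append (diWalk_of_diDist_eq hyv))
    obtain ⟨y', hadj, hmem', hzy'⟩ := ih (i + 1) (by omega) z hz b hzv (by
      intro c hcF
      obtain rfl : c = col (edgeFromEnd G x v t) := hF hcF hc
      have hnot : t ∉ {s | s ∈ tightLevels G col v (col (edgeFromEnd G x v t)) ∧ s < b + 1} := by
        rintro ⟨-, h⟩
        omega
      have hsub : insert t
          {s | s ∈ tightLevels G col v (col (edgeFromEnd G x v t)) ∧ s < b + 1} ⊆
          {s | s ∈ tightLevels G col v (col (edgeFromEnd G x v t)) ∧ s < k + 1} := by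
        rintro s (rfl | ⟨hs, hsb⟩)
        · exact ⟨hmem, htk⟩
        · exact ⟨hs, by omega⟩
      have hcard := (Set.encard_le_encard hsub).trans (hlev _ hcF)
      rw [Set.encard_insert_of_notMem hnot, Nat.cast_add, Nat.cast_one] at hcard
      exact (ENat.add_le_add_iff_right ENat.one_ne_top).1 hcard)
    refine ⟨y', hadj, hmem', ?_⟩
    have hw : DiWalk (diDeleteColors G col F) x y' k := by
      have := ((diWalk_of_diDist_eq hxu).append (diWalk_of_diDist_eq ha)).append
        (diWalk_of_diDist_eq hzy')
      rwa [show k + 1 - l + a + b = k by omega] at this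
    rw [← hk'] at hk
    exact (diDist_eq_of_split hk hw (.cons hadj (.nil v))).1

/-- The edges in `lastEdges` preserve all distances from `S 0` after any fault of one color. -/
theorem diWalk_lastEdges [Fintype V] {S : ℕ → Finset V} {L : ℕ → ℕ} {Δ : ℕ} (hL : ∀ i, 1 ≤ L i)
    (hS : ∀ i ≤ Δ, Hits G col (S i) (L i)) (hT : ∀ v c, (tightLevels G col v c).encard ≤ Δ)
    (hF : F.Subsingleton) {x : V} (hx : x ∈ S 0) (k : ℕ) (v : V)
    (hk : diDist (diDeleteColors G col F) x v = k) :
    DiWalk (diDeleteColors (restrict G (lastEdges G col S L Δ : Set (V × V))) col F) x v k := by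
  induction k generalizing v with
  | zero =>
    obtain rfl := (diWalk_of_diDist_eq hk).eq_of_zero rfl
    exact .nil x
  | succ k ih =>
    obtain ⟨y, hadj, hmem, hxy⟩ := exists_lastEdge hL hS hF v Δ 0 (by omega) x hx k hk
      fun c _ => (Set.encard_le_encard fun t ht => ht.1).trans (hT v c)
    exact (ih y hxy).concat ⟨⟨hadj.1, hmem⟩, hadj.2⟩

theorem Hits.reverse {S : Finset V} {l : ℕ} (h : Hits G col S l) :
    Hits (reverse G) (col ∘ Prod.swap) S l := by
  intro F hF u y huy
  simp only [diDist_deleteColors_reverse] at huy ⊢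
  obtain ⟨x, hx, hsum⟩ := h F hF y u huy
  exact ⟨x, hx, by rw [add_comm, hsum]⟩

end Sourcewise

/-! ### Pairwise preservers -/

section Pairwise

variable {V : Type*} {C : Type*} {G : Digraph V} {col : V × V → C} {F : Set C}

/-- The first `l` edges of the replacement paths between the pairs in `P`, for no fault and for
faults among the last `l` edges of the fixed shortest path. -/
noncomputable def shortPathEdges (G : Digraph V) (col : V × V → C) (P : Finset (V × V)) (l : ℕ) :
    Finset (V × V) :=
  open Classical in
  (P ×ˢ range (l + 1) ×ˢ range l).image fun q =>
    let D := replacementGraph G col q.1.1 q.1.2 l q.2.1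
    (shortestPath D q.1.1 q.1.2 q.2.2, shortestPath D q.1.1 q.1.2 (q.2.2 + 1))

theorem card_shortPathEdges_le (G : Digraph V) (col : V × V → C) (P : Finset (V × V)) (l : ℕ) :
    #(shortPathEdges G col P l) ≤ #P * ((l + 1) * l) := by
  classical
  refine card_image_le.trans ?_
  simp [card_product]

theorem diWalk_shortPathEdges {P : Finset (V × V)} {l k : ℕ} {p : V × V} (hp : p ∈ P)
    (hF : F.Subsingleton) (hk : diDist (diDeleteColors G col F) p.1 p.2 = k) (hkl : k ≤ l) :
    DiWalk (diDeleteColors (restrict G (shortPathEdges G col P l : Set (V × V))) col F)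
      p.1 p.2 k := by
  classical
  have hle := diDist_le_deleteColors G col F p.1 p.2
  rw [hk] at hle
  obtain ⟨t, ht, hD, hadj⟩ := exists_replacementGraph (l := l) hF hk fun t ht _ => by
    have : t < k := by exact_mod_cast ht.trans_le hle
    omega
  obtain ⟨h0, hend, -⟩ := shortestPath_spec hD
  set D := replacementGraph G col p.1 p.2 l t with hDdef
  have hadj' : ∀ i < k,
      (diDeleteColors (restrict G (shortPathEdges G col P l : Set (V × V))) col F).Adj
        (shortestPath D p.1 p.2 i) (shortestPath D p.1 p.2 (i + 1)) := by
    intro i hi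
    refine ⟨⟨(hadj i hi).1, mem_coe.2 (mem_image.2 ⟨(p, t, i), ?_, rfl⟩)⟩, (hadj i hi).2⟩
    simp only [mem_product, hp, mem_range, true_and]
    omega
  have hw := diWalk_of_fun hadj' 0 k (by omega)
  rwa [zero_add, h0, hend] at hw

/-- All edges of the pairwise preserver: the replacement paths with at most `L 0` edges, and the
edges preserving the distances from `S 0` and to `S 0`. -/
noncomputable def preserverEdges [Fintype V] (G : Digraph V) (col : V × V → C)
    (P : Finset (V × V)) (S : ℕ → Finset V) (L : ℕ → ℕ) (Δ : ℕ) : Finset (V × V) :=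
  open Classical in
  shortPathEdges G col P (L 0) ∪ (lastEdges G col S L Δ ∪
    (lastEdges (reverse G) (col ∘ Prod.swap) S L Δ).image Prod.swap)

theorem card_preserverEdges_le [Fintype V] (G : Digraph V) (col : V × V → C)
    (P : Finset (V × V)) (S : ℕ → Finset V) (L : ℕ → ℕ) (Δ : ℕ) : #(preserverEdges G col P S L Δ) ≤
      #P * ((L 0 + 1) * L 0) +
        2 * ∑ i ∈ range (Δ + 1), #(S i) * (Fintype.card V * (L (i + 1) + 1)) := by
  classical
  have h₁ := card_shortPathEdges_le G col P (L 0)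
  have h₂ := card_lastEdges_le G col S L Δ
  have h₃ := card_lastEdges_le (reverse G) (col ∘ Prod.swap) S L Δ
  have h₄ := card_image_le (f := Prod.swap)
    (s := lastEdges (reverse G) (col ∘ Prod.swap) S L Δ)
  have h₅ := card_union_le (shortPathEdges G col P (L 0)) (lastEdges G col S L Δ ∪
    (lastEdges (reverse G) (col ∘ Prod.swap) S L Δ).image Prod.swap)
  have h₆ := card_union_le (lastEdges G col S L Δ)
    ((lastEdges (reverse G) (col ∘ Prod.swap) S L Δ).image Prod.swap)
  rw [preserverEdges]
  omega

theorem diWalk_preserverEdges [Fintype V] {P : Finset (V × V)} {S : ℕ → Finset V} {L : ℕ → ℕ} {Δ : ℕ}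
    (hL : ∀ i, 1 ≤ L i) (hS : ∀ i ≤ Δ, Hits G col (S i) (L i))
    (hT : ∀ v c, (tightLevels G col v c).encard ≤ Δ)
    (hT' : ∀ v c, (tightLevels (reverse G) (col ∘ Prod.swap) v c).encard ≤ Δ)
    (hF : F.Subsingleton) {p : V × V} (hp : p ∈ P) {k : ℕ}
    (hk : diDist (diDeleteColors G col F) p.1 p.2 = k) :
    DiWalk (diDeleteColors (restrict G (preserverEdges G col P S L Δ : Set (V × V))) col F)
      p.1 p.2 k := by
  classical
  -- A path of more than `L 0` edges is split at a vertex `x ∈ S 0` on its last `L 0` vertices.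
  rcases le_or_gt k (L 0) with hkl | hkl
  · refine restrict_walk_mono ?_ (diWalk_shortPathEdges hp hF hk hkl)
    exact coe_subset.2 subset_union_left
  have hL0 := hL 0
  rw [show k = (k - (L 0 - 1)) + (L 0 - 1) by omega] at hk
  obtain ⟨u, hsu, hut⟩ := exists_diDist_split hk
  obtain ⟨x, hx, hsum⟩ := hS 0 (Nat.zero_le _) F hF u p.2 hut
  obtain ⟨a, b, ha, hb, hab⟩ := exists_natCast_of_add_eq hsum
  have hk' : diDist (diDeleteColors G col F) p.1 p.2 = (((k - (L 0 - 1)) + a) + b : ℕ) := by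
    rw [hk, ← hab, add_assoc]
  obtain ⟨hsx, hxt⟩ := diDist_eq_of_split hk'
    ((diWalk_of_diDist_eq hsu).append (diWalk_of_diDist_eq ha)) (diWalk_of_diDist_eq hb)
  have hw₂ := diWalk_lastEdges hL hS hT hF hx _ _ hxt
  rw [← diDist_deleteColors_reverse] at hsx
  have hw₁ := (diWalk_lastEdges hL (fun i hi => (hS i hi).reverse) hT' hF hx _ _ hsx).reverse
  have hw₁' : DiWalk (diDeleteColors
      (restrict G (preserverEdges G col P S L Δ : Set (V × V))) col F) p.1 x
      ((k - (L 0 - 1)) + a) := by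
    refine hw₁.mono ?_
    rintro c d ⟨⟨hG, hE⟩, hF⟩
    exact ⟨⟨hG, mem_coe.2 (mem_union_right _ (mem_union_right _
      (mem_image.2 ⟨(d, c), hE, rfl⟩)))⟩, hF⟩
  have hw := hw₁'.append (restrict_walk_mono
    (coe_subset.2 (subset_union_left.trans subset_union_right)) hw₂)
  rwa [show k - (L 0 - 1) + a + b = k by omega] at hw

end Pairwise

/-! ### The size of the preserver -/

section Size

variable {V : Type*} {C : Type*}

theorem sizeBound_nonneg (n p Δ : ℕ) : 0 ≤ sizeBound n p Δ := by
  unfold sizeBound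
  have := Real.log_natCast_nonneg n
  positivity

theorem exists_deleteColors_eq (G : Digraph V) (col : V × V → C) {F : Set C}
    (hF : F.Subsingleton) : ∃ o : Option (V × V),
      diDeleteColors G col F = diDeleteColors G col {c | ∃ e ∈ o, c = col e} := by
  by_cases h : ∃ e, col e ∈ F
  · obtain ⟨e, he⟩ := h
    refine ⟨some e, ?_⟩
    rw [hF.eq_singleton_of_mem he]
    congr 1
    ext c
    simp
  · push Not at h
    refine ⟨none, ?_⟩
    simp [diDeleteColors, h]

theorem exists_hits [Fintype V] (hn : 2 ≤ Fintype.card V) (G : Digraph V) (col : V × V → C) {l : ℕ}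
    (hl : 1 ≤ l) : ∃ S : Finset V,
      (#S : ℝ) * l ≤ 7 * (Fintype.card V * Real.log (Fintype.card V)) ∧ Hits G col S l := by
  classical
  -- Only the colors of pairs of vertices matter as faults: at most `n ^ 2 + 1` graphs `G - F` occur.
  let D : Option (V × V) → Digraph V := fun o => diDeleteColors G col {c | ∃ e ∈ o, c = col e}
  let ι := {q : V × V × Option (V × V) // diDist (D q.2.2) q.1 q.2.1 = (l - 1 : ℕ)}
  let B : ι → Finset V := fun q => univ.filter fun x =>
    diDist (D q.1.2.2) q.1.1 x + diDist (D q.1.2.2) x q.1.2.1 = (l - 1 : ℕ)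
  have hι : Fintype.card ι ≤ Fintype.card V ^ 5 := by
    refine (Fintype.card_subtype_le _).trans ?_
    simp only [Fintype.card_prod, Fintype.card_option]
    generalize Fintype.card V = n at hn
    have h₁ : n * n + 1 ≤ n * n * n := by nlinarith
    calc n * (n * (n * n + 1)) ≤ n * (n * (n * n * n)) := by gcongr
      _ = n ^ 5 := by ring
  have hB : ∀ q, l ≤ #(B q) := by
    rintro ⟨⟨u, y, o⟩, hq⟩
    have hsplit : ∀ j ∈ range l, diDist (D o) u (shortestPath (D o) u y j) = j ∧
        diDist (D o) (shortestPath (D o) u y j) y = (l - 1 - j : ℕ) := fun j hj =>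
      diDist_shortestPath hq (by have := mem_range.1 hj; omega)
    have hcard : #((range l).image (shortestPath (D o) u y)) = l := by
      rw [card_image_of_injOn, card_range]
      intro i hi j hj hij
      have h₁ := (hsplit i hi).1
      rw [hij, (hsplit j hj).1] at h₁
      exact_mod_cast h₁.symm
    refine hcard.symm.le.trans (card_le_card ?_)
    intro x hx
    obtain ⟨j, hj, rfl⟩ := mem_image.1 hx
    refine mem_filter.2 ⟨mem_univ _, ?_⟩
    rw [(hsplit j hj).1, (hsplit j hj).2]
    have := mem_range.1 hj
    norm_cast
    omega
  obtain ⟨S, hS, hhit⟩ := exists_hitting_set hn hι B l hl hB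
  refine ⟨S, hS, fun F hF u y huy => ?_⟩
  obtain ⟨o, ho⟩ := exists_deleteColors_eq G col hF
  rw [ho] at huy ⊢
  obtain ⟨x, hx, hxB⟩ := hhit ⟨(u, y, o), huy⟩
  exact ⟨x, hx, (mem_filter.1 hxB).2⟩

/-- The base `r` of the scales: the rounded value of `ρ = (n ^ 2 / p) ^ (1 / (2 Δ + 3))`, for which
the contributions `p ρ ^ (2 Δ + 2)` and `n ^ 2 / ρ` to the size are equal. -/
theorem exists_scale {n p : ℕ} (hn : 2 ≤ n) (hp1 : 1 ≤ p) (hpn : p ≤ n ^ 2) (Δ : ℕ) :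
    ∃ r : ℕ, 1 ≤ r ∧ (r : ℝ) ^ (2 * Δ + 3) * p ≤ (n : ℝ) ^ 2 ∧
      (n : ℝ) ^ 2 * (Δ * Real.log n) ≤ 2 * r * sizeBound n p Δ := by
  have hn0 : (0 : ℝ) < n := by positivity
  have hp0 : (0 : ℝ) < p := by positivity
  have hpn' : (p : ℝ) ≤ (n : ℝ) ^ 2 := by exact_mod_cast hpn
  set m : ℝ := 2 * (Δ : ℝ) + 3 with hm
  have hm0 : 0 < m := by positivity
  set ρ : ℝ := ((n : ℝ) ^ 2 / p) ^ (1 / m) with hρ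
  have hρ1 : 1 ≤ ρ := Real.one_le_rpow ((one_le_div hp0).2 hpn') (by positivity)
  have hρpow : ρ ^ (2 * Δ + 3) * p = (n : ℝ) ^ 2 := by
    have : ρ ^ (2 * Δ + 3) = (n : ℝ) ^ 2 / p := by
      rw [← Real.rpow_natCast, hρ, ← Real.rpow_mul (by positivity)]
      push_cast
      rw [← hm, one_div_mul_cancel hm0.ne', Real.rpow_one]
    rw [this]
    field_simp
  have hbound : ρ * sizeBound n p Δ = (n : ℝ) ^ 2 * (Δ * Real.log n) := by
    have h₁ : ρ = (n : ℝ) ^ (2 / m) / (p : ℝ) ^ (1 / m) := by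
      rw [hρ, Real.div_rpow (by positivity) (by positivity), ← Real.rpow_natCast,
        ← Real.rpow_mul hn0.le]
      congr 2
      push_cast
      ring
    rw [sizeBound, ← hm, Real.rpow_sub hn0, h₁, Real.rpow_two]
    field_simp
  have hsize : 0 ≤ sizeBound n p Δ := sizeBound_nonneg n p Δ
  refine ⟨⌊ρ⌋₊, (Nat.one_le_floor_iff ρ).2 hρ1, ?_, ?_⟩
  · rw [← hρpow]
    gcongr
    exact Nat.floor_le (by linarith)
  · rw [← hbound]
    have h₁ := Nat.lt_floor_add_one ρ
    have h₂ : (1 : ℝ) ≤ ⌊ρ⌋₊ := by exact_mod_cast (Nat.one_le_floor_iff ρ).2 hρ1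
    gcongr
    linarith

theorem card_preserverEdges_le_sizeBound [Fintype V] (hn : 2 ≤ Fintype.card V) (G : Digraph V)
    (col : V × V → C) {Δ r : ℕ} (hΔ : 1 ≤ Δ) (hr : 1 ≤ r) {P : Finset (V × V)}
    {S : ℕ → Finset V} {L : ℕ → ℕ} (hL : ∀ i, L i = r ^ (Δ + 1 - i))
    (hS : ∀ i, (#(S i) : ℝ) * L i ≤ 7 * (Fintype.card V * Real.log (Fintype.card V)))
    (hrP : (r : ℝ) ^ (2 * Δ + 3) * #P ≤ (Fintype.card V : ℝ) ^ 2)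
    (hrs : (Fintype.card V : ℝ) ^ 2 * (Δ * Real.log (Fintype.card V)) ≤
      2 * r * sizeBound (Fintype.card V) #P Δ) :
    (#(preserverEdges G col P S L Δ) : ℝ) ≤ 120 * sizeBound (Fintype.card V) #P Δ := by
  have hcard : (#(preserverEdges G col P S L Δ) : ℝ) ≤ #P * ((L 0 + 1) * L 0) +
      2 * ∑ i ∈ range (Δ + 1), (#(S i) : ℝ) * (Fintype.card V * (L (i + 1) + 1)) := by
    exact_mod_cast card_preserverEdges_le G col P S L Δ
  generalize Fintype.card V = n at *
  have hlog : (1 / 2 : ℝ) ≤ Real.log n := by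
    have h2 : Real.log 2 ≤ Real.log n := Real.log_le_log (by norm_num) (by exact_mod_cast hn)
    linarith [Real.log_two_gt_d9]
  have hΔ' : (1 : ℝ) ≤ Δ := by exact_mod_cast hΔ
  have hr0 : (0 : ℝ) < r := by exact_mod_cast hr
  have hL1 : ∀ i, (1 : ℝ) ≤ L i := fun i => by
    rw [hL]
    exact_mod_cast Nat.one_le_pow _ _ hr
  have hshort : r * (#P * (((L 0 : ℝ) + 1) * L 0)) ≤ 2 * (n : ℝ) ^ 2 := by
    have hL0 : (L 0 : ℝ) = (r : ℝ) ^ (Δ + 1) := by rw [hL]; push_cast; rfl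
    have := hL1 0
    calc r * (#P * (((L 0 : ℝ) + 1) * L 0)) ≤ r * (#P * ((L 0 + L 0) * L 0)) := by gcongr
      _ = 2 * ((r : ℝ) ^ (2 * Δ + 3) * #P) := by rw [hL0]; ring
      _ ≤ _ := by gcongr
  have hterm : ∀ i ∈ range (Δ + 1), r * ((#(S i) : ℝ) * (n * (L (i + 1) + 1))) ≤
      14 * ((n : ℝ) ^ 2 * Real.log n) := by
    intro i hi
    have hi' : i < Δ + 1 := mem_range.1 hi
    have hLi : (L i : ℝ) = r * L (i + 1) := by
      rw [hL, hL]
      push_cast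
      rw [← pow_succ']
      congr 1
      omega
    have := hL1 (i + 1)
    calc r * ((#(S i) : ℝ) * (n * (L (i + 1) + 1)))
        ≤ r * ((#(S i) : ℝ) * (n * (L (i + 1) + L (i + 1)))) := by gcongr
      _ = 2 * n * (#(S i) * L i) := by rw [hLi]; ring
      _ ≤ 2 * n * (7 * (n * Real.log n)) := mul_le_mul_of_nonneg_left (hS i) (by positivity)
      _ = _ := by ring
  have hlong : r * ∑ i ∈ range (Δ + 1), (#(S i) : ℝ) * (n * (L (i + 1) + 1)) ≤
      28 * ((n : ℝ) ^ 2 * (Δ * Real.log n)) := by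
    rw [mul_sum]
    refine (sum_le_card_nsmul _ _ _ hterm).trans ?_
    rw [card_range, nsmul_eq_mul]
    push_cast
    have : 0 ≤ (n : ℝ) ^ 2 * Real.log n := by positivity
    nlinarith
  have hn2 : (n : ℝ) ^ 2 ≤ 2 * ((n : ℝ) ^ 2 * (Δ * Real.log n)) := by
    have : (1 / 2 : ℝ) ≤ Δ * Real.log n := by nlinarith
    nlinarith [sq_nonneg (n : ℝ)]
  refine le_of_mul_le_mul_left ?_ hr0
  calc r * (#(preserverEdges G col P S L Δ) : ℝ)
      ≤ r * (#P * ((L 0 + 1) * L 0) +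
        2 * ∑ i ∈ range (Δ + 1), (#(S i) : ℝ) * (n * (L (i + 1) + 1))) := by gcongr
    _ = r * (#P * (((L 0 : ℝ) + 1) * L 0)) +
        2 * (r * ∑ i ∈ range (Δ + 1), (#(S i) : ℝ) * (n * (L (i + 1) + 1))) := by ring
    _ ≤ 60 * ((n : ℝ) ^ 2 * (Δ * Real.log n)) := by linarith
    _ ≤ r * (120 * sizeBound n #P Δ) := by linarith

/-- Without tight edges no vertex reaches another one. -/
theorem eq_of_tightLevels {G : Digraph V} {col : V × V → C} {F : Set C}
    (hT : ∀ v c, (tightLevels G col v c).encard ≤ 0) {u v : V} {k : ℕ}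
    (hk : diDist (diDeleteColors G col F) u v = k) : u = v := by
  have hle := diDist_le_deleteColors G col F u v
  rw [hk] at hle
  obtain ⟨d, hd⟩ := ENat.ne_top_iff_exists.1 (ne_top_of_le_ne_top (ENat.natCast_ne_top k) hle)
  rcases Nat.eq_zero_or_pos d with hd0 | hd0
  · exact (diWalk_of_diDist_eq hd.symm).eq_of_zero hd0
  · have hmem : 0 ∈ tightLevels G col v (col (edgeFromEnd G u v 0)) :=
      mem_tightLevels (by rw [← hd]; exact_mod_cast hd0) (by simp [← hd])
    have := hT v (col (edgeFromEnd G u v 0))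
    rw [nonpos_iff_eq_zero, Set.encard_eq_zero] at this
    exact absurd hmem (this ▸ Set.notMem_empty 0)

/-- If every color has at most `Δ` levels both towards and away from each vertex, then a set of
edges within the size bound preserves the distances of the pairs in `P` after any fault of one
color. -/
theorem exists_preserving_edges [Fintype V] (G : Digraph V) (col : V × V → C) (Δ : ℕ)
    (P : Finset (V × V)) (hT : ∀ v c, (tightLevels G col v c).encard ≤ Δ)
    (hT' : ∀ v c, (tightLevels (reverse G) (col ∘ Prod.swap) v c).encard ≤ Δ) :
    ∃ E : Finset (V × V), (#E : ℝ) ≤ 120 * sizeBound (Fintype.card V) #P Δ ∧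
      ∀ F : Set C, F.Subsingleton → ∀ p ∈ P, ∀ k : ℕ,
        diDist (diDeleteColors G col F) p.1 p.2 = k →
        DiWalk (diDeleteColors (restrict G (E : Set (V × V))) col F) p.1 p.2 k := by
  by_cases htriv : ∀ F : Set C, F.Subsingleton → ∀ p ∈ P, ∀ k : ℕ,
      diDist (diDeleteColors G col F) p.1 p.2 = k → p.1 = p.2
  · refine ⟨∅, by simpa using sizeBound_nonneg _ _ _, fun F hF p hp k hk => ?_⟩
    have heq := htriv F hF p hp k hk
    have h0 : (k : ℕ∞) ≤ (0 : ℕ) := by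
      rw [← hk, heq]
      exact diDist_le (.nil _)
    obtain rfl : k = 0 := by
      norm_cast at h0
      omega
    rw [heq]
    exact .nil _
  · push Not at htriv
    obtain ⟨F, -, p, hp, k, hk, hne⟩ := htriv
    have hn : 2 ≤ Fintype.card V := Fintype.one_lt_card_iff.2 ⟨_, _, hne⟩
    have hΔ : 1 ≤ Δ := by
      by_contra hΔ
      obtain rfl : Δ = 0 := by omega
      exact hne (eq_of_tightLevels hT hk)
    have hPcard : #P ≤ Fintype.card V ^ 2 := by
      simpa [sq] using card_le_univ P
    obtain ⟨r, hr, hrP, hrs⟩ := exists_scale hn (card_pos.2 ⟨p, hp⟩) hPcard Δ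
    obtain ⟨L, hL⟩ : ∃ L : ℕ → ℕ, ∀ i, L i = r ^ (Δ + 1 - i) := ⟨_, fun _ => rfl⟩
    have hL1 : ∀ i, 1 ≤ L i := fun i => by rw [hL]; exact Nat.one_le_pow _ _ hr
    choose S hScard hShit using fun i => exists_hits hn G col (hL1 i)
    exact ⟨preserverEdges G col P S L Δ,
      card_preserverEdges_le_sizeBound hn G col hΔ hr hL hScard hrP hrs,
      fun F hF p hp k hk => diWalk_preserverEdges hL1 (fun i _ => hShit i) hT hT' hF hp hk⟩

end Size

/-! ### Directed graphs -/

section Directed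

variable {V : Type*} {C : Type*}

theorem tightLevels_encard_le {G : Digraph V} {col : V × V → C} {Δ : ℕ}
    (hG : DiClassesLE G col Δ) (v : V) (c : C) : (tightLevels G col v c).encard ≤ Δ := by
  refine le_trans ?_ (hG c)
  refine (Set.encard_le_encard ?_).trans
    (Set.encard_image_le (fun e : V × V => (diDist G e.2 v).toNat) _)
  rintro t ⟨a, b, hab, hc, -, hb⟩
  exact ⟨(a, b), ⟨hab, hc⟩, by simp [hb]⟩

theorem DiClassesLE.reverse {G : Digraph V} {col : V × V → C} {Δ : ℕ}
    (hG : DiClassesLE G col Δ) : DiClassesLE (reverse G) (col ∘ Prod.swap) Δ := by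
  intro c
  refine le_trans ?_ (hG c)
  refine (Set.encard_le_encard ?_).trans (Set.encard_image_le Prod.swap _)
  rintro ⟨a, b⟩ ⟨hab, hc⟩
  exact ⟨(b, a), ⟨hab, hc⟩, rfl⟩

theorem exists_isDiDistPreserver [Fintype V] (G : Digraph V) (col : V × V → C) (Δ : ℕ)
    (P : Finset (V × V)) (hG : DiClassesLE G col Δ) :
    ∃ H : Digraph V, IsDiDistPreserver 1 G col (P : Set (V × V)) H ∧
      ((diEdgeSet H).ncard : ℝ) ≤ 120 * sizeBound (Fintype.card V) #P Δ := by
  obtain ⟨E, hE, hwalk⟩ := exists_preserving_edges G col Δ P (tightLevels_encard_le hG)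
    (tightLevels_encard_le hG.reverse)
  refine ⟨restrict G E, ⟨?_, fun F hF p hp => le_antisymm ?_ ?_⟩, le_trans ?_ hE⟩
  · rintro a b ⟨hab, -⟩
    exact hab
  · rw [Nat.cast_one, Set.encard_le_one_iff_subsingleton] at hF
    exact diDist_le_of_diWalk fun k hk => hwalk F hF p hp k hk
  · refine diDist_anti ?_ _ _
    rintro a b ⟨⟨hab, -⟩, hF⟩
    exact ⟨hab, hF⟩
  · rw [← Set.ncard_coe_finset]
    exact_mod_cast Set.ncard_le_ncard (s := diEdgeSet (restrict G E)) (fun e he => he.2)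
      E.finite_toSet

end Directed

/-! ### Undirected graphs -/

section Undirected

variable {V : Type*} {C : Type*}

/-- The digraph with both orientations of every edge of `G`. -/
def orient (G : SimpleGraph V) : Digraph V where
  Adj u v := G.Adj u v

theorem diWalk_orient (G : SimpleGraph V) (u v : V) (k : ℕ) :
    DiWalk (orient G) u v k ↔ ∃ w : G.Walk u v, w.length = k := by
  constructor
  · intro h
    induction h with
    | nil u => exact ⟨.nil, rfl⟩
    | cons hadj _ ih =>
      obtain ⟨w, rfl⟩ := ih
      exact ⟨.cons hadj w, rfl⟩
  · rintro ⟨w, rfl⟩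
    induction w with
    | nil => exact .nil _
    | cons hadj _ ih => exact .cons hadj ih

theorem diDist_orient (G : SimpleGraph V) (u v : V) : diDist (orient G) u v = G.edist u v := by
  rw [SimpleGraph.edist_eq_sInf, diDist]
  congr 1
  ext d
  simp only [diWalk_orient, Set.mem_ofPred_eq, Set.mem_range]
  constructor
  · rintro ⟨_, ⟨w, rfl⟩, rfl⟩
    exact ⟨w, rfl⟩
  · rintro ⟨w, rfl⟩
    exact ⟨_, ⟨w, rfl⟩, rfl⟩

theorem orient_deleteColors (G : SimpleGraph V) (col : Sym2 V → C) (F : Set C) :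
    orient (deleteColors G col F) = diDeleteColors (orient G) (col ∘ Sym2.mk.uncurry) F := by
  ext u v
  simp [orient, deleteColors, diDeleteColors]

/-- Both orientations of an edge have the same color, but at most one of them lies on a shortest
path to `v`: the one leading to the endpoint that is closer to `v`. -/
theorem tightLevels_orient_encard_le {G : SimpleGraph V} {col : Sym2 V → C} {Δ : ℕ}
    (hG : ClassesLE G col Δ) (v : V) (c : C) :
    (tightLevels (orient G) (col ∘ Sym2.mk.uncurry) v c).encard ≤ Δ := by
  let D : V → ℕ := fun a => (diDist (orient G) a v).toNat
  refine le_trans ?_ (hG c)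
  refine (Set.encard_le_encard ?_).trans
    (Set.encard_image_le (Sym2.lift ⟨fun a b => min (D a) (D b), fun a b => min_comm _ _⟩) _)
  rintro t ⟨a, b, hab, hc, ha, hb⟩
  refine ⟨s(a, b), ⟨hab, hc⟩, ?_⟩
  simp only [Sym2.lift_mk, D, ha, hb, ENat.toNat_natCast]
  omega

theorem exists_isDistPreserver [Fintype V] (G : SimpleGraph V) (col : Sym2 V → C) (Δ : ℕ)
    (P : Finset (V × V)) (hG : ClassesLE G col Δ) :
    ∃ H : SimpleGraph V, IsDistPreserver 1 G col (P : Set (V × V)) H ∧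
      (H.edgeSet.ncard : ℝ) ≤ 120 * sizeBound (Fintype.card V) #P Δ := by
  have hrev : reverse (orient G) = orient G := by
    ext u v
    exact G.adj_comm v u
  have hcol : (col ∘ Sym2.mk.uncurry) ∘ Prod.swap = col ∘ Sym2.mk.uncurry := by
    funext e
    exact congrArg col Sym2.eq_swap
  obtain ⟨E, hE, hwalk⟩ := exists_preserving_edges (orient G) (col ∘ Sym2.mk.uncurry) Δ P
    (tightLevels_orient_encard_le hG)
    (by rw [hrev, hcol]; exact tightLevels_orient_encard_le hG)
  let H : SimpleGraph V :=
    { Adj := fun u v => G.Adj u v ∧ ((u, v) ∈ E ∨ (v, u) ∈ E)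
      symm := ⟨fun u v h => ⟨h.1.symm, h.2.symm⟩⟩
      loopless := ⟨fun u h => h.1.ne rfl⟩ }
  refine ⟨H, ⟨fun u v h => h.1, fun F hF p hp => ?_⟩, le_trans ?_ hE⟩
  · rw [← diDist_orient, ← diDist_orient, orient_deleteColors, orient_deleteColors]
    rw [Nat.cast_one, Set.encard_le_one_iff_subsingleton] at hF
    refine le_antisymm (diDist_le_of_diWalk fun k hk => (hwalk F hF p hp k hk).mono ?_)
      (diDist_anti ?_ _ _)
    · rintro a b ⟨⟨hab, hmem⟩, hc⟩
      exact ⟨⟨hab, .inl hmem⟩, hc⟩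
    · rintro a b ⟨⟨hab, -⟩, hc⟩
      exact ⟨hab, hc⟩
  · have hsub : H.edgeSet ⊆ Sym2.mk.uncurry '' (E : Set (V × V)) := by
      intro e
      induction e with
      | _ u v =>
        rintro ⟨-, h | h⟩
        · exact ⟨(u, v), h, rfl⟩
        · exact ⟨(v, u), h, Sym2.eq_swap⟩
    have h₁ := Set.ncard_le_ncard hsub (E.finite_toSet.image _)
    have h₂ := Set.ncard_image_le (f := Sym2.mk.uncurry) E.finite_toSet
    rw [Set.ncard_coe_finset] at h₂
    exact_mod_cast h₁.trans h₂

end Undirected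

end ColorFT

/-- There is one absolute constant `K` such that every edge-colored unweighted `n`-vertex graph,
undirected (first part) or directed (second part), with color classes of size at most `Δ`, has for
every pair set `P` a `1`-color-fault-tolerant `P`-distance preserver with at most
`K * n ^ (2 - 2 / (2 Δ + 3)) * |P| ^ (1 / (2 Δ + 3)) * Δ * log n` edges. -/
theorem theorem1p2 :
    ∃ K : ℝ, 0 < K ∧
      (∀ (V : Type*) [Fintype V] (C : Type*) (G : SimpleGraph V) (col : Sym2 V → C) (Δ : ℕ)
        (P : Finset (V × V)), ColorFT.ClassesLE G col Δ →
        ∃ H : SimpleGraph V, ColorFT.IsDistPreserver 1 G col (P : Set (V × V)) H ∧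
          (H.edgeSet.ncard : ℝ) ≤ K * ColorFT.sizeBound (Fintype.card V) P.card Δ) ∧
      (∀ (V : Type*) [Fintype V] (C : Type*) (G : Digraph V) (col : V × V → C) (Δ : ℕ)
        (P : Finset (V × V)), ColorFT.DiClassesLE G col Δ →
        ∃ H : Digraph V, ColorFT.IsDiDistPreserver 1 G col (P : Set (V × V)) H ∧
          ((ColorFT.diEdgeSet H).ncard : ℝ) ≤
            K * ColorFT.sizeBound (Fintype.card V) P.card Δ) := by
  exact ⟨120, by norm_num, fun V _ C => ColorFT.exists_isDistPreserver,
    fun V _ C => ColorFT.exists_isDiDistPreserver⟩
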